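/- Theorem (Witnessed Bound). Let $\mu$ be a Borel probability measure on $\mathbb R^d$ with support $K$, let $\ell>0$ be real, and suppose that $\mu$ has dimension at most $\ell$ with constant $\alpha_\mu>0$, i.e. $\mu(B(p,r))\ge \alpha_\mu r^\ell$ for every $p\in K$ and every $0<r<\operatorname{diam} K$. Let $P\subset\mathbb R^d$ be a finite set, let $1\le k\le |P|$, set $m_0=k/|P|$, and let $\mathbf 1_P=\frac1{|P|}\sum_{p\in P}\delta_p$. For each $x\in\mathbb R^d$ let $\mathrm{NN}(x)\subseteq P$ be a set of $k$ nearest neighbours of $x$ in $P$ (ties being broken arbitrarily). For $C\subseteq P$ with $|C|=k$ write $\bar c_C=\frac1k\sum_{p\in C}p$ and $w_C=-\frac1k\sum_{p\in C}\|\bar c_C-p\|^2$. The $k$-distance $d_{P,k}$ and the witnessed $k$-distance $d^w_{P,k}$ are the non-negative functions given by $$d_{P,k}(x)^2=\frac1k\sum_{p\in \mathrm{NN}(x)}\|x-p\|^2,\qquad d^w_{P,k}(x)^2=\min_{p\in P}\bigl(\|x-\bar c_{\mathrm{NN}(p)}\|^2-w_{\mathrm{NN}(p)}\bigr).$$ Let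 $d_K(x)=\inf_{y\in K}\|x-y\|$, let $\|f\|_\infty=\sup_{x\in\mathbb R^d}|f(x)|$, and let $W_2(\mu,\nu)$ be the infimum of $\bigl(\int\|x-y\|^2\,d\pi(x,y)\bigr)^{1/2}$ over all measures $\pi$ on $\mathbb R^d\times\mathbb R^d$ with marginals $\mu$ and $\nu$. Then $W_2(\mu,\mathbf 1_P)<\infty$ and $$\|d^w_{P,k}-d_K\|_\infty\le 6\,m_0^{-1/2}\,W_2(\mu,\mathbf 1_P)+24\,m_0^{1/\ell}\alpha_\mu^{-1/\ell}.$$ The right-hand side is at most $24$ times the bound that holds for the exact $k$-distance, $$\|d_{P,k}-d_K\|_\infty\le m_0^{-1/2}\,W_2(\mu,\mathbf 1_P)+m_0^{1/\ell}\alpha_\mu^{-1/\ell}.$$ -/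

import Mathlib

open MeasureTheory
open scoped ENNReal

noncomputable section

/-- A transport plan between `μ` and `ν`: a measure on the product with marginals `μ` and `ν`. -/
def IsTransportPlan {d : ℕ} (μ ν : Measure (EuclideanSpace ℝ (Fin d)))
    (π : Measure (EuclideanSpace ℝ (Fin d) × EuclideanSpace ℝ (Fin d))) : Prop :=
  π.map Prod.fst = μ ∧ π.map Prod.snd = ν

/-- The cost `(∫ ‖x - y‖² dπ(x, y))^(1/2)` of a transport plan, with values in `[0, ∞]`. -/
def transportCost {d : ℕ}
    (π : Measure (EuclideanSpace ℝ (Fin d) × EuclideanSpace ℝ (Fin d))) : ℝ≥0∞ :=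
  (∫⁻ z, ‖z.1 - z.2‖ₑ ^ 2 ∂π) ^ (1 / 2 : ℝ)

/-- The Wasserstein distance of exponent two, with values in `[0, ∞]`. -/
def wasserstein2 {d : ℕ} (μ ν : Measure (EuclideanSpace ℝ (Fin d))) : ℝ≥0∞ :=
  ⨅ (π : Measure (EuclideanSpace ℝ (Fin d) × EuclideanSpace ℝ (Fin d)))
    (_ : IsTransportPlan μ ν π), transportCost π

/-- The uniform probability measure on a finite set of points. -/
def uniformMeasure {d : ℕ} (P : Finset (EuclideanSpace ℝ (Fin d))) :
    Measure (EuclideanSpace ℝ (Fin d)) :=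
  (P.card : ℝ≥0∞)⁻¹ • ∑ p ∈ P, Measure.dirac p

/-- `μ` has dimension at most `l`, with constant `α`: every ball of radius `r` centred in the
support of `μ` has mass at least `α r ^ l`, for `r` smaller than the diameter of the support.
(The diameter is taken in `[0, ∞]`. Asking this of all closed balls or of all open balls with
`0 < r` is the same, by continuity from below.) -/
def HasDimensionAtMost {d : ℕ} (μ : Measure (EuclideanSpace ℝ (Fin d))) (l α : ℝ) : Prop :=
  0 < α ∧ ∀ p ∈ μ.support, ∀ r : ℝ, 0 < r → ENNReal.ofReal r < Metric.ediam μ.support →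
    ENNReal.ofReal (α * r ^ l) ≤ μ (Metric.closedBall p r)

/-- `S` is a set of `k` nearest neighbours of `x` in `P`. If ties occur there are several. -/
def IsKNearest {d : ℕ} (P : Finset (EuclideanSpace ℝ (Fin d))) (k : ℕ)
    (x : EuclideanSpace ℝ (Fin d)) (S : Finset (EuclideanSpace ℝ (Fin d))) : Prop :=
  S ⊆ P ∧ S.card = k ∧ ∀ p ∈ S, ∀ q ∈ P, q ∉ S → dist x p ≤ dist x q

/-- The barycenter of a finite set of points. -/
def barycenter {d : ℕ} (S : Finset (EuclideanSpace ℝ (Fin d))) : EuclideanSpace ℝ (Fin d) :=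
  (S.card : ℝ)⁻¹ • ∑ p ∈ S, p

/-- The (non-positive) weight attached to the barycenter of a finite set of points. -/
def baryWeight {d : ℕ} (S : Finset (EuclideanSpace ℝ (Fin d))) : ℝ :=
  -((S.card : ℝ)⁻¹ * ∑ p ∈ S, ‖barycenter S - p‖ ^ 2)

/-- The `k`-distance, for a choice `nn x` of `k` nearest neighbours of each point `x`. -/
def kDistance {d : ℕ} (k : ℕ)
    (nn : EuclideanSpace ℝ (Fin d) → Finset (EuclideanSpace ℝ (Fin d)))
    (x : EuclideanSpace ℝ (Fin d)) : ℝ :=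
  √((k : ℝ)⁻¹ * ∑ p ∈ nn x, ‖x - p‖ ^ 2)

/-- The witnessed `k`-distance to `P`: the square root of the power distance to the barycenters
of the sets `nn p` with `p ∈ P`, where `nn p` consists of `p` and its `k - 1` nearest neighbours
in `P` (that is, of `k` nearest neighbours of `p` in `P`, as `p ∈ P` is nearest to itself). -/
def witnessedKDistance {d : ℕ} (P : Finset (EuclideanSpace ℝ (Fin d)))
    (nn : EuclideanSpace ℝ (Fin d) → Finset (EuclideanSpace ℝ (Fin d)))
    (x : EuclideanSpace ℝ (Fin d)) : ℝ :=
  √(⨅ p : {p // p ∈ P}, (‖x - barycenter (nn p)‖ ^ 2 - baryWeight (nn p)))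

/-- The supremum norm of a real function, with values in `[0, ∞]`. -/
def supNorm {d : ℕ} (f : EuclideanSpace ℝ (Fin d) → ℝ) : ℝ≥0∞ := ⨆ x, ‖f x‖ₑ

end

/-! Expanding squares around the barycenter turns each power distance into a mean square distance.
So the witnessed distance at `x` is the minimum over `p ∈ P` of `rmsDist (nn p) x`, and the
`k`-distance is `rmsDist (nn x) x`.

Up to the factor `√m₀`, the `k`-distance is the least `L²` distance from `x` to a submeasure of
`uniformMeasure P` of mass `m₀`. Carrying mass `m₀` along a transport plan therefore compares it
with `μ`. Mass of `μ` in a ball around `x` of radius `d_K(x) + r`, where `r = (m₀/α)^(1/l)`, gives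
the upper bound (`rmsDist_le_of_plan`). Mass on `nn x`, moved back to the support, gives the lower
bound (`infDist_le_of_plan`). Minkowski's inequality pays for the transport.

The witnessed distance dominates the `k`-distance, since every `nn p` competes with `nn x`.
Conversely, a sample point near the projection of `x` to the support is a good witness. With `W =
m₀^(-1/2) W₂` this gives the error `3 (r + W)`, sharper than the stated constants. -/

namespace WitnessedDistance

variable {d : ℕ}

local notation "E" => EuclideanSpace ℝ (Fin d)

/-! ### Mean square distances to finite sets. -/

/-- The root mean square distance of `x` to the points of `S`. -/
noncomputable def rmsDist (S : Finset E) (x : E) : ℝ :=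
  √((S.card : ℝ)⁻¹ * ∑ p ∈ S, ‖x - p‖ ^ 2)

theorem rmsDist_nonneg (S : Finset E) (x : E) : 0 ≤ rmsDist S x := Real.sqrt_nonneg _

theorem rmsDist_sq (S : Finset E) (x : E) :
    rmsDist S x ^ 2 = (S.card : ℝ)⁻¹ * ∑ p ∈ S, ‖x - p‖ ^ 2 :=
  Real.sq_sqrt (by positivity)

theorem sum_barycenter_sub (S : Finset E) : ∑ p ∈ S, (barycenter S - p) = 0 := by
  rcases S.eq_empty_or_nonempty with rfl | h
  · simp
  · have hc : (S.card : ℝ) ≠ 0 := by simpa using h.ne_empty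
    rw [Finset.sum_sub_distrib, Finset.sum_const, barycenter, ← Nat.cast_smul_eq_nsmul ℝ, smul_smul,
      mul_inv_cancel₀ hc, one_smul, sub_self]

/-- The power distance to a barycenter is the mean square distance to the points. -/
theorem norm_sub_barycenter_sq_sub_baryWeight {S : Finset E} (h : S.Nonempty) (x : E) :
    ‖x - barycenter S‖ ^ 2 - baryWeight S = rmsDist S x ^ 2 := by
  have hc : (S.card : ℝ) ≠ 0 := by simpa using h.ne_empty
  have hexp : ∀ p ∈ S, ‖x - p‖ ^ 2 = ‖x - barycenter S‖ ^ 2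
      + 2 * inner ℝ (x - barycenter S) (barycenter S - p) + ‖barycenter S - p‖ ^ 2 := by
    intro p _
    rw [← norm_add_sq_real, sub_add_sub_cancel]
  rw [rmsDist_sq, Finset.sum_congr rfl hexp, Finset.sum_add_distrib, Finset.sum_add_distrib,
    ← Finset.mul_sum, ← inner_sum, sum_barycenter_sub, baryWeight]
  simp only [Finset.sum_const, nsmul_eq_mul, inner_zero_right, mul_zero, add_zero]
  field_simp
  ring

/-- Minkowski's inequality for the uniform measure on `S`: after the square is expanded,
Cauchy-Schwarz bounds the mean in the cross term by the quadratic mean. -/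
theorem rmsDist_le_dist_add (S : Finset E) (x y : E) :
    rmsDist S x ≤ dist x y + rmsDist S y := by
  rcases S.eq_empty_or_nonempty with rfl | h
  · simp [rmsDist, dist_nonneg]
  have hc : 0 < (S.card : ℝ) := by exact_mod_cast h.card_pos
  have hmean : (S.card : ℝ)⁻¹ * ∑ p ∈ S, ‖y - p‖ ≤ rmsDist S y := by
    apply Real.le_sqrt_of_sq_le
    have := sq_sum_le_card_mul_sum_sq (s := S) (f := fun p => ‖y - p‖)
    rw [mul_pow, inv_pow, sq (S.card : ℝ), mul_inv, mul_assoc]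
    gcongr
    rwa [inv_mul_le_iff₀ hc]
  apply Real.sqrt_le_iff.2 ⟨by have := rmsDist_nonneg S y; positivity, ?_⟩
  have hsum : ∑ p ∈ S, ‖x - p‖ ^ 2 ≤
      S.card * dist x y ^ 2 + 2 * dist x y * ∑ p ∈ S, ‖y - p‖ + ∑ p ∈ S, ‖y - p‖ ^ 2 := by
    calc ∑ p ∈ S, ‖x - p‖ ^ 2 ≤ ∑ p ∈ S, (dist x y + ‖y - p‖) ^ 2 := by
          gcongr with p
          rw [dist_eq_norm]
          exact norm_sub_le_norm_sub_add_norm_sub x y p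
      _ = _ := by
          simp only [add_sq, Finset.sum_add_distrib, Finset.mul_sum, Finset.sum_const,
            nsmul_eq_mul]
  calc (S.card : ℝ)⁻¹ * ∑ p ∈ S, ‖x - p‖ ^ 2
      ≤ (S.card : ℝ)⁻¹ * (S.card * dist x y ^ 2 + 2 * dist x y * ∑ p ∈ S, ‖y - p‖
          + ∑ p ∈ S, ‖y - p‖ ^ 2) := by gcongr
    _ = dist x y ^ 2 + 2 * dist x y * ((S.card : ℝ)⁻¹ * ∑ p ∈ S, ‖y - p‖) + rmsDist S y ^ 2 := by
        rw [rmsDist_sq]; field_simp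
    _ ≤ dist x y ^ 2 + 2 * dist x y * rmsDist S y + rmsDist S y ^ 2 := by gcongr
    _ = _ := by ring

theorem exists_mem_dist_le_rmsDist {S : Finset E} (h : S.Nonempty) (x : E) :
    ∃ p ∈ S, dist x p ≤ rmsDist S x := by
  have hc : 0 < (S.card : ℝ) := by exact_mod_cast h.card_pos
  obtain ⟨p, hp, hmin⟩ := S.exists_min_image (dist x) h
  refine ⟨p, hp, Real.le_sqrt_of_sq_le ?_⟩
  rw [le_inv_mul_iff₀ hc, ← nsmul_eq_mul]
  refine Finset.card_nsmul_le_sum _ _ _ fun q hq => ?_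
  rw [← dist_eq_norm]
  gcongr
  exact hmin q hq

/-- The sum over the nearest neighbours is a minimum over all weights `≤ a` of the same mass. -/
theorem mul_sum_nearest_le {P S : Finset E} {k : ℕ} {x : E} (hS : IsKNearest P k x S)
    (w : E → ℝ) (a : ℝ) (hw0 : ∀ p ∈ P, 0 ≤ w p) (hwa : ∀ p ∈ P, w p ≤ a)
    (hw : ∑ p ∈ P, w p = a * k) :
    a * ∑ p ∈ S, ‖x - p‖ ^ 2 ≤ ∑ p ∈ P, w p * ‖x - p‖ ^ 2 := by
  obtain ⟨hSP, hcard, hnear⟩ := hS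
  rcases S.eq_empty_or_nonempty with rfl | h
  · simpa using Finset.sum_nonneg fun p hp => mul_nonneg (hw0 p hp) (sq_nonneg ‖x - p‖)
  -- Both weightings have total mass `a * k`, so subtracting the largest squared distance `t` in `S`
  -- changes both sides equally. Then the terms in `S` are nonpositive, so weight `a` is best there,
  -- and the terms outside are nonnegative, so weight `0` is best.
  obtain ⟨m, hm, hmax⟩ := S.exists_max_image (fun p => ‖x - p‖ ^ 2) h
  set t := ‖x - m‖ ^ 2
  have key : ∑ p ∈ S, a * (‖x - p‖ ^ 2 - t) ≤ ∑ p ∈ P, w p * (‖x - p‖ ^ 2 - t) := by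
    classical
    rw [← Finset.sum_sdiff hSP]
    have h1 : 0 ≤ ∑ p ∈ P \ S, w p * (‖x - p‖ ^ 2 - t) := by
      refine Finset.sum_nonneg fun p hp => ?_
      rw [Finset.mem_sdiff] at hp
      refine mul_nonneg (hw0 p hp.1) (sub_nonneg.2 ?_)
      have := hnear m hm p hp.1 hp.2
      rw [dist_eq_norm, dist_eq_norm] at this
      simp only [t]
      gcongr
    have h2 : ∑ p ∈ S, a * (‖x - p‖ ^ 2 - t) ≤ ∑ p ∈ S, w p * (‖x - p‖ ^ 2 - t) := by
      refine Finset.sum_le_sum fun p hp => ?_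
      exact mul_le_mul_of_nonpos_right (hwa p (hSP hp)) (sub_nonpos.2 (hmax p hp))
    linarith
  simp only [mul_sub, Finset.sum_sub_distrib, ← Finset.mul_sum, ← Finset.sum_mul, hw,
    Finset.sum_const, nsmul_eq_mul, hcard] at key
  linarith

/-! ### The uniform measure and its submeasures. -/

theorem lintegral_uniformMeasure (P : Finset E) (f : E → ℝ≥0∞) :
    ∫⁻ p, f p ∂(uniformMeasure P) = (P.card : ℝ≥0∞)⁻¹ * ∑ p ∈ P, f p := by
  simp [uniformMeasure]

theorem uniformMeasure_apply_le (P : Finset E) (p : E) :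
    uniformMeasure P {p} ≤ (P.card : ℝ≥0∞)⁻¹ := by
  classical
  simp only [uniformMeasure, Measure.smul_apply, Measure.finsetSum_apply, smul_eq_mul]
  refine mul_le_of_le_one_right' ?_
  simp only [Measure.dirac_apply, Set.indicator_apply, Set.mem_singleton_iff, Pi.one_apply,
    Finset.sum_ite_eq']
  split_ifs <;> simp

theorem uniformMeasure_compl (P : Finset E) : uniformMeasure P (P : Set E)ᶜ = 0 := by
  classical
  simp only [uniformMeasure, Measure.smul_apply, Measure.finsetSum_apply, smul_eq_mul]
  refine mul_eq_zero_of_right _ (Finset.sum_eq_zero fun p hp => ?_)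
  simp [Measure.dirac_apply, hp]

theorem lintegral_of_compl_null {ν : Measure E} {P : Finset E} (h : ν (P : Set E)ᶜ = 0)
    (f : E → ℝ≥0∞) : ∫⁻ p, f p ∂ν = ∑ p ∈ P, f p * ν {p} := by
  rw [← lintegral_finset, Measure.restrict_eq_self_of_ae_mem (s := (P : Set E))]
  exact h

theorem ofReal_norm_sq (v : E) : ENNReal.ofReal (‖v‖ ^ 2) = ‖v‖ₑ ^ 2 := by
  rw [ENNReal.ofReal_pow (norm_nonneg v), ofReal_norm]

/-- The `k`-distance is minimal among the submeasures of the uniform measure of mass `k / |P|`. -/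
theorem ofReal_mul_rmsDist_sq_le_lintegral {P S : Finset E} {k : ℕ} {x : E} (hk : 1 ≤ k)
    (hS : IsKNearest P k x S) {ν : Measure E} (hν : ν ≤ uniformMeasure P)
    (hmass : ν Set.univ = ENNReal.ofReal ((k : ℝ) / P.card)) :
    ENNReal.ofReal ((k : ℝ) / P.card * rmsDist S x ^ 2) ≤ ∫⁻ q, ‖x - q‖ₑ ^ 2 ∂ν := by
  have hPc : 0 < P.card := by
    have := Finset.card_le_card hS.1
    have := hS.2.1
    omega
  have hnull : ν (P : Set E)ᶜ = 0 :=
    le_antisymm ((hν _).trans (uniformMeasure_compl P).le) bot_le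
  have hle (p : E) : ν {p} ≤ (P.card : ℝ≥0∞)⁻¹ := (hν _).trans (uniformMeasure_apply_le P p)
  have hfin (p : E) : ν {p} ≠ ∞ :=
    ((hle p).trans_lt (by simpa using Finset.card_pos.1 hPc)).ne
  have hof (p : E) : ENNReal.ofReal (ν {p}).toReal = ν {p} := ENNReal.ofReal_toReal (hfin p)
  have hsum : ∑ p ∈ P, (ν {p}).toReal = (P.card : ℝ)⁻¹ * k := by
    have := lintegral_of_compl_null hnull (fun _ => 1)
    rw [lintegral_one, hmass] at this
    rw [← ENNReal.toReal_sum fun p _ => hfin p]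
    simp only [one_mul] at this
    rw [← this, ENNReal.toReal_ofReal (by positivity)]
    ring
  have key := mul_sum_nearest_le hS (fun p => (ν {p}).toReal) (P.card : ℝ)⁻¹
    (fun p _ => ENNReal.toReal_nonneg) (fun p _ => by
      have := ENNReal.toReal_mono (ENNReal.inv_ne_top.2 (by exact_mod_cast hPc.ne')) (hle p)
      simpa using this) hsum
  rw [lintegral_of_compl_null hnull]
  calc ENNReal.ofReal ((k : ℝ) / P.card * rmsDist S x ^ 2)
      ≤ ENNReal.ofReal (∑ p ∈ P, (ν {p}).toReal * ‖x - p‖ ^ 2) := by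
        apply ENNReal.ofReal_le_ofReal
        rw [rmsDist_sq, hS.2.1]
        have : (k : ℝ) ≠ 0 := by positivity
        calc _ = (P.card : ℝ)⁻¹ * ∑ p ∈ S, ‖x - p‖ ^ 2 := by field_simp
          _ ≤ _ := key
    _ = _ := by
        rw [ENNReal.ofReal_sum_of_nonneg fun p _ => by positivity]
        refine Finset.sum_congr rfl fun p _ => ?_
        rw [ENNReal.ofReal_mul ENNReal.toReal_nonneg, hof, ofReal_norm_sq, mul_comm]

/-- The restriction to `S` attains the minimum in `ofReal_mul_rmsDist_sq_le_lintegral`. -/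
theorem lintegral_nearest {P S : Finset E} {k : ℕ} {x : E} (hk : 1 ≤ k)
    (hS : IsKNearest P k x S) :
    ∫⁻ q in (S : Set E), ‖x - q‖ₑ ^ 2 ∂(uniformMeasure P)
      = ENNReal.ofReal ((k : ℝ) / P.card * rmsDist S x ^ 2) := by
  classical
  have hPc : 0 < P.card := by
    have := Finset.card_le_card hS.1
    have := hS.2.1
    omega
  have hk0 : (k : ℝ) ≠ 0 := by positivity
  rw [← lintegral_indicator S.measurableSet, lintegral_uniformMeasure, rmsDist_sq, hS.2.1]
  have h1 : (k : ℝ) / P.card * ((k : ℝ)⁻¹ * ∑ p ∈ S, ‖x - p‖ ^ 2)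
      = (P.card : ℝ)⁻¹ * ∑ p ∈ S, ‖x - p‖ ^ 2 := by field_simp
  rw [h1, ENNReal.ofReal_mul (by positivity), ENNReal.ofReal_sum_of_nonneg fun p _ => by positivity,
    ENNReal.ofReal_inv_of_pos (by exact_mod_cast hPc), ENNReal.ofReal_natCast]
  congr 1
  simp only [ofReal_norm_sq, Set.indicator_apply, Finset.mem_coe]
  rw [← Finset.sum_filter, Finset.filter_mem_eq_inter, Finset.inter_eq_right.2 hS.1]

theorem uniformMeasure_nearest {P S : Finset E} {k : ℕ} {x : E} (hk : 1 ≤ k)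
    (hS : IsKNearest P k x S) :
    uniformMeasure P (S : Set E) = ENNReal.ofReal ((k : ℝ) / P.card) := by
  classical
  have hPc : 0 < P.card := by
    have := Finset.card_le_card hS.1
    have := hS.2.1
    omega
  rw [← lintegral_indicator_one S.measurableSet, lintegral_uniformMeasure, div_eq_inv_mul,
    ENNReal.ofReal_mul (by positivity),
    ENNReal.ofReal_inv_of_pos (by exact_mod_cast hPc), ENNReal.ofReal_natCast,
    ENNReal.ofReal_natCast]
  congr 1
  simp only [Set.indicator_apply, Finset.mem_coe, Pi.one_apply]
  rw [← Finset.sum_filter, Finset.filter_mem_eq_inter, Finset.inter_eq_right.2 hS.1]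
  simp [hS.2.1]

/-! ### Estimates along a transport plan. -/

theorem transportCost_mono {π π' : Measure (E × E)} (h : π' ≤ π) :
    transportCost π' ≤ transportCost π :=
  ENNReal.rpow_le_rpow (lintegral_mono' h le_rfl) (by norm_num)

theorem minkowski_two (π : Measure (E × E)) {f g h : E × E → ℝ≥0∞} (hf : Measurable f)
    (hg : Measurable g) (hle : ∀ z, h z ≤ f z + g z) :
    (∫⁻ z, h z ^ 2 ∂π) ^ (1 / 2 : ℝ)
      ≤ (∫⁻ z, f z ^ 2 ∂π) ^ (1 / 2 : ℝ) + (∫⁻ z, g z ^ 2 ∂π) ^ (1 / 2 : ℝ) := by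
  have key := ENNReal.lintegral_Lp_add_le (μ := π) (p := 2) hf.aemeasurable hg.aemeasurable
    (by norm_num)
  simp only [Pi.add_apply, ENNReal.rpow_ofNat] at key
  refine le_trans ?_ key
  gcongr with z
  exact hle z

theorem measurable_enorm_sub_fst (x : E) : Measurable fun z : E × E => ‖x - z.1‖ₑ := by fun_prop

theorem measurable_enorm_sub_snd (x : E) : Measurable fun z : E × E => ‖x - z.2‖ₑ := by fun_prop

theorem measurable_enorm_fst_sub_snd : Measurable fun z : E × E => ‖z.1 - z.2‖ₑ := by fun_prop

theorem sqrt_lintegral_snd_le (π : Measure (E × E)) (x : E) :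
    (∫⁻ z, ‖x - z.2‖ₑ ^ 2 ∂π) ^ (1 / 2 : ℝ)
      ≤ (∫⁻ z, ‖x - z.1‖ₑ ^ 2 ∂π) ^ (1 / 2 : ℝ) + transportCost π :=
  minkowski_two π (measurable_enorm_sub_fst x) measurable_enorm_fst_sub_snd fun z => by
    simpa using enorm_add_le (x - z.1) (z.1 - z.2)

theorem sqrt_lintegral_fst_le (π : Measure (E × E)) (x : E) :
    (∫⁻ z, ‖x - z.1‖ₑ ^ 2 ∂π) ^ (1 / 2 : ℝ)
      ≤ (∫⁻ z, ‖x - z.2‖ₑ ^ 2 ∂π) ^ (1 / 2 : ℝ) + transportCost π :=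
  minkowski_two π (measurable_enorm_sub_snd x) measurable_enorm_fst_sub_snd fun z => by
    rw [← enorm_neg (z.1 - z.2)]
    simpa using enorm_add_le (x - z.2) (-(z.1 - z.2))

theorem ofReal_mul_sq_rpow {m a : ℝ} (hm : 0 ≤ m) (ha : 0 ≤ a) :
    ENNReal.ofReal (m * a ^ 2) ^ (1 / 2 : ℝ) = ENNReal.ofReal (√m * a) := by
  rw [ENNReal.ofReal_rpow_of_nonneg (by positivity) (by norm_num), ← Real.sqrt_eq_rpow,
    Real.sqrt_mul hm, Real.sqrt_sq ha]

/-- If a ball around `x` has enough mass for `μ`, then its radius bounds the `k`-distance, up to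
the cost of transport. -/
theorem rmsDist_le_of_plan {μ : Measure E} [IsProbabilityMeasure μ] {P S : Finset E} {k : ℕ} {x : E}
    (hk : 1 ≤ k) (hS : IsKNearest P k x S) {π : Measure (E × E)}
    (hπ : IsTransportPlan μ (uniformMeasure P) π) {R : ℝ} (hR : 0 ≤ R)
    (hball : ENNReal.ofReal ((k : ℝ) / P.card) ≤ μ (Metric.closedBall x R)) :
    ENNReal.ofReal (√((k : ℝ) / P.card) * rmsDist S x)
      ≤ ENNReal.ofReal (√((k : ℝ) / P.card) * R) + transportCost π := by
  have hPc : 0 < P.card := by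
    have := Finset.card_le_card hS.1
    have := hS.2.1
    omega
  set m : ℝ := (k : ℝ) / P.card
  have hm : 0 < m := by positivity
  set B := Metric.closedBall x R
  have hB : MeasurableSet B := measurableSet_closedBall
  have hB0 : μ B ≠ 0 := (lt_of_lt_of_le (ENNReal.ofReal_pos.2 hm) hball).ne'
  -- The ball may carry more than `m`. Scaling by `c ≤ 1` leaves mass exactly `m` and keeps `π'`
  -- below `π`.
  set c : ℝ≥0∞ := ENNReal.ofReal m / μ B
  have hc : c ≤ 1 := ENNReal.div_le_of_le_mul (by simpa using hball)
  have hcB : c * μ B = ENNReal.ofReal m := ENNReal.div_mul_cancel hB0 (measure_ne_top _ _)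
  set π' := c • π.restrict (Prod.fst ⁻¹' B)
  have hπ' : π' ≤ π := by
    refine Measure.le_iff.2 fun s _ => ?_
    simp only [π', Measure.smul_apply, smul_eq_mul]
    exact (mul_le_of_le_one_left' hc).trans (Measure.restrict_apply_le _ _)
  have hπB : π (Prod.fst ⁻¹' B) = μ B := by
    rw [← hπ.1, Measure.map_apply measurable_fst hB]
  have hmass : π' Set.univ = ENNReal.ofReal m := by
    simp [π', hπB, hcB]
  have hsub : π'.map Prod.snd ≤ uniformMeasure P := by
    rw [← hπ.2]
    exact Measure.map_mono hπ' measurable_snd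
  have h1 := ofReal_mul_rmsDist_sq_le_lintegral hk hS hsub (by
    rw [Measure.map_apply measurable_snd MeasurableSet.univ, Set.preimage_univ, hmass])
  rw [lintegral_map (by fun_prop) measurable_snd] at h1
  have h2 : ∫⁻ z, ‖x - z.1‖ₑ ^ 2 ∂π' ≤ ENNReal.ofReal (m * R ^ 2) := by
    have : ∫⁻ z in Prod.fst ⁻¹' B, ‖x - z.1‖ₑ ^ 2 ∂π ≤ ENNReal.ofReal (R ^ 2) * μ B := by
      rw [← hπB]
      rw [← setLIntegral_const]
      refine setLIntegral_mono measurable_const fun z hz => ?_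
      rw [← ofReal_norm_sq, ← dist_eq_norm, dist_comm]
      gcongr
      exact hz
    simp only [π', lintegral_smul_measure, smul_eq_mul]
    calc c * ∫⁻ z in Prod.fst ⁻¹' B, ‖x - z.1‖ₑ ^ 2 ∂π
        ≤ c * (ENNReal.ofReal (R ^ 2) * μ B) := by gcongr
      _ = ENNReal.ofReal (m * R ^ 2) := by
          rw [ENNReal.ofReal_mul hm.le, ← hcB]; ring
  have hhalf : (0 : ℝ) ≤ 1 / 2 := by norm_num
  calc ENNReal.ofReal (√m * rmsDist S x)
      = ENNReal.ofReal (m * rmsDist S x ^ 2) ^ (1 / 2 : ℝ) :=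
        (ofReal_mul_sq_rpow hm.le (rmsDist_nonneg S x)).symm
    _ ≤ (∫⁻ z, ‖x - z.2‖ₑ ^ 2 ∂π') ^ (1 / 2 : ℝ) := ENNReal.rpow_le_rpow h1 hhalf
    _ ≤ _ := sqrt_lintegral_snd_le π' x
    _ ≤ ENNReal.ofReal (m * R ^ 2) ^ (1 / 2 : ℝ) + transportCost π :=
        add_le_add (ENNReal.rpow_le_rpow h2 hhalf) (transportCost_mono hπ')
    _ = _ := by rw [ofReal_mul_sq_rpow hm.le hR]

/-- The distance to the support is at most the `k`-distance, up to the cost of transport. -/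
theorem infDist_le_of_plan {μ : Measure E} [IsProbabilityMeasure μ] {P S : Finset E} {k : ℕ} {x : E}
    (hk : 1 ≤ k) (hS : IsKNearest P k x S) {π : Measure (E × E)}
    (hπ : IsTransportPlan μ (uniformMeasure P) π) :
    ENNReal.ofReal (√((k : ℝ) / P.card) * Metric.infDist x μ.support)
      ≤ ENNReal.ofReal (√((k : ℝ) / P.card) * rmsDist S x) + transportCost π := by
  set m : ℝ := (k : ℝ) / P.card
  have hm : 0 ≤ m := by positivity
  -- The part of the plan that ends in `S` has mass `m`, and almost all of it starts in the support
  -- of `μ`.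
  set A : Set (E × E) := Prod.snd ⁻¹' (S : Set E)
  have hA : MeasurableSet A := measurable_snd S.measurableSet
  set π' := π.restrict A
  have hmass : π A = ENNReal.ofReal m := by
    rw [← uniformMeasure_nearest hk hS, ← hπ.2, Measure.map_apply measurable_snd S.measurableSet]
  have hsupp : ∀ᵐ z ∂π, z.1 ∈ μ.support := by
    have : ∀ᵐ y ∂(π.map Prod.fst), y ∈ μ.support := by
      rw [hπ.1]
      exact Measure.support_mem_ae
    exact ae_of_ae_map measurable_fst.aemeasurable this
  have h1 : ENNReal.ofReal (m * Metric.infDist x μ.support ^ 2) ≤ ∫⁻ z, ‖x - z.1‖ₑ ^ 2 ∂π' := by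
    calc ENNReal.ofReal (m * Metric.infDist x μ.support ^ 2)
        = ∫⁻ _, ENNReal.ofReal (Metric.infDist x μ.support ^ 2) ∂π' := by
          rw [lintegral_const, ENNReal.ofReal_mul hm, Measure.restrict_apply_univ, hmass, mul_comm]
      _ ≤ _ := by
          refine lintegral_mono_ae ((ae_restrict_of_ae hsupp).mono fun z hz => ?_)
          rw [← ofReal_norm_sq, ← dist_eq_norm]
          gcongr
          · exact Metric.infDist_nonneg
          · exact Metric.infDist_le_dist_of_mem hz
  have h2 : ∫⁻ z, ‖x - z.2‖ₑ ^ 2 ∂π' = ENNReal.ofReal (m * rmsDist S x ^ 2) := by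
    rw [← lintegral_nearest hk hS, ← hπ.2, setLIntegral_map S.measurableSet (by fun_prop)
      measurable_snd]
  calc ENNReal.ofReal (√m * Metric.infDist x μ.support)
      = ENNReal.ofReal (m * Metric.infDist x μ.support ^ 2) ^ (1 / 2 : ℝ) :=
        (ofReal_mul_sq_rpow hm Metric.infDist_nonneg).symm
    _ ≤ (∫⁻ z, ‖x - z.1‖ₑ ^ 2 ∂π') ^ (1 / 2 : ℝ) := ENNReal.rpow_le_rpow h1 (by norm_num)
    _ ≤ _ := sqrt_lintegral_fst_le π' x
    _ ≤ ENNReal.ofReal (m * rmsDist S x ^ 2) ^ (1 / 2 : ℝ) + transportCost π := by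
        rw [h2]
        gcongr
        exact transportCost_mono Measure.restrict_le_self
    _ = _ := by rw [ofReal_mul_sq_rpow hm (rmsDist_nonneg S x)]

/-- Passes from all plans to the infimum. Finiteness matters, as `toReal` sends `∞` to `0`. -/
theorem le_add_toReal_wasserstein2 {μ ν : Measure E} (hW : wasserstein2 μ ν ≠ ∞) {a b : ℝ}
    (hb : 0 ≤ b)
    (h : ∀ π, IsTransportPlan μ ν π →
      ENNReal.ofReal a ≤ ENNReal.ofReal b + transportCost π) :
    a ≤ b + (wasserstein2 μ ν).toReal := by
  have : ENNReal.ofReal (a - b) ≤ wasserstein2 μ ν := by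
    refine le_iInf₂ fun π hπ => ?_
    rw [ENNReal.ofReal_sub _ hb]
    exact tsub_le_iff_left.2 (h π hπ)
  have := (ENNReal.ofReal_le_iff_le_toReal hW).1 this
  linarith

/-! ### Consequences of the dimension bound, and finiteness of the Wasserstein distance. -/

/-- With infinite diameter the mass bound would hold at every radius, and radius `(2 / α) ^ (1 / l)`
would give a ball of mass at least `2`. -/
theorem isBounded_support {μ : Measure E} [IsProbabilityMeasure μ] {l α : ℝ} (hl : 0 < l)
    (hμ : HasDimensionAtMost μ l α) : Bornology.IsBounded μ.support := by
  rw [Metric.isBounded_iff_ediam_ne_top]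
  by_contra hinf
  obtain ⟨hα, hdim⟩ := hμ
  obtain ⟨p, hp⟩ : μ.support.Nonempty := Measure.nonempty_support (IsProbabilityMeasure.ne_zero μ)
  have h2 : (0 : ℝ) < (2 / α) ^ (1 / l) := by positivity
  have := hdim p hp _ h2 (by rw [hinf]; exact ENNReal.ofReal_lt_top)
  rw [← Real.rpow_mul (by positivity), one_div_mul_cancel hl.ne', Real.rpow_one,
    mul_div_cancel₀ _ hα.ne'] at this
  have := this.trans prob_le_one
  norm_num at this

/-- Balls around points of the support, of radius `(m / α) ^ (1 / l)`, have mass at least `m`. -/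
theorem ofReal_le_measure_closedBall {μ : Measure E} [IsProbabilityMeasure μ] {l α : ℝ}
    (hl : 0 < l) (hμ : HasDimensionAtMost μ l α) {m : ℝ} (hm : 0 < m) (hm1 : m ≤ 1) {p : E}
    (hp : p ∈ μ.support) :
    ENNReal.ofReal m ≤ μ (Metric.closedBall p ((m / α) ^ (1 / l))) := by
  have hα := hμ.1
  have hr : 0 < (m / α) ^ (1 / l) := by positivity
  -- The dimension bound is silent once the radius reaches the diameter, but then the ball contains
  -- the whole support and has mass `1`.
  rcases lt_or_ge (ENNReal.ofReal ((m / α) ^ (1 / l))) (Metric.ediam μ.support) with h | h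
  · have := hμ.2 p hp _ hr h
    rwa [← Real.rpow_mul (by positivity), one_div_mul_cancel hl.ne', Real.rpow_one,
      mul_div_cancel₀ _ hα.ne'] at this
  · have hsub : μ.support ⊆ Metric.closedBall p ((m / α) ^ (1 / l)) := by
      intro q hq
      rw [Metric.mem_closedBall, ← ENNReal.ofReal_le_ofReal_iff hr.le, ← edist_dist]
      exact (Metric.edist_le_ediam_of_mem hq hp).trans h
    have h1 : μ (Metric.closedBall p ((m / α) ^ (1 / l))) = 1 :=
      mem_ae_iff_prob_eq_one measurableSet_closedBall |>.1
        (Filter.mem_of_superset Measure.support_mem_ae hsub)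
    rw [h1]
    exact ENNReal.ofReal_le_one.2 hm1

theorem isProbabilityMeasure_uniformMeasure {P : Finset E} (hP : P.Nonempty) :
    IsProbabilityMeasure (uniformMeasure P) := by
  refine ⟨?_⟩
  rw [← lintegral_one, lintegral_uniformMeasure]
  simp only [Finset.sum_const, nsmul_eq_mul, mul_one]
  exact ENNReal.inv_mul_cancel (by simpa using hP.ne_empty) (ENNReal.natCast_ne_top _)

/-- The product measure is a plan, and its cost is finite because both marginals live on bounded
sets. -/
theorem wasserstein2_ne_top {μ : Measure E} [IsProbabilityMeasure μ]
    (hb : Bornology.IsBounded μ.support) {P : Finset E} (hP : P.Nonempty) :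
    wasserstein2 μ (uniformMeasure P) ≠ ∞ := by
  have := isProbabilityMeasure_uniformMeasure hP
  have hplan : IsTransportPlan μ (uniformMeasure P) (μ.prod (uniformMeasure P)) := by
    constructor
    · simp [Measure.map_fst_prod]
    · simp [Measure.map_snd_prod]
  refine ((iInf₂_le _ hplan).trans_lt ?_).ne
  obtain ⟨C, hC⟩ := (hb.union P.finite_toSet.isBounded).exists_norm_le
  have h1 : ∀ᵐ z ∂(μ.prod (uniformMeasure P)), z.1 ∈ μ.support :=
    Measure.quasiMeasurePreserving_fst.ae Measure.support_mem_ae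
  have h2 : ∀ᵐ z ∂(μ.prod (uniformMeasure P)), z.2 ∈ (P : Set E) :=
    Measure.quasiMeasurePreserving_snd.ae (uniformMeasure_compl P)
  refine ENNReal.rpow_lt_top_of_nonneg (by norm_num) ?_
  refine ((lintegral_mono_ae (g := fun _ => ENNReal.ofReal ((C + C) ^ 2)) ?_).trans_lt ?_).ne
  · filter_upwards [h1, h2] with z hz1 hz2
    rw [← ofReal_norm_sq]
    gcongr
    exact (norm_sub_le _ _).trans (add_le_add (hC _ (Or.inl hz1)) (hC _ (Or.inr hz2)))
  · simp

theorem supNorm_le {f : E → ℝ} {b : ℝ} (h : ∀ x, |f x| ≤ b) :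
    supNorm f ≤ ENNReal.ofReal b :=
  iSup_le fun x => by
    rw [Real.enorm_eq_ofReal_abs]
    exact ENNReal.ofReal_le_ofReal (h x)

end WitnessedDistance

/-! ### Assembly of the bounds. -/

open WitnessedDistance in
theorem mainTheorem2 {d : ℕ} (μ : Measure (EuclideanSpace ℝ (Fin d))) [IsProbabilityMeasure μ]
    (l α : ℝ) (hl : 0 < l) (hμ : HasDimensionAtMost μ l α)
    (P : Finset (EuclideanSpace ℝ (Fin d))) (k : ℕ) (hk : 1 ≤ k) (hkP : k ≤ P.card)
    (nn : EuclideanSpace ℝ (Fin d) → Finset (EuclideanSpace ℝ (Fin d)))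
    (hnn : ∀ x, IsKNearest P k x (nn x))
    (m₀ : ℝ) (hm₀ : m₀ = (k : ℝ) / (P.card : ℝ)) :
    wasserstein2 μ (uniformMeasure P) ≠ ∞ ∧
    supNorm (fun x => witnessedKDistance P nn x - Metric.infDist x μ.support) ≤
      ENNReal.ofReal (6 * m₀ ^ (-(1 / 2) : ℝ) * (wasserstein2 μ (uniformMeasure P)).toReal
        + 24 * m₀ ^ (1 / l) * α ^ (-(1 / l))) ∧
    supNorm (fun x => kDistance k nn x - Metric.infDist x μ.support) ≤
      ENNReal.ofReal (m₀ ^ (-(1 / 2) : ℝ) * (wasserstein2 μ (uniformMeasure P)).toReal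
        + m₀ ^ (1 / l) * α ^ (-(1 / l))) ∧
    6 * m₀ ^ (-(1 / 2) : ℝ) * (wasserstein2 μ (uniformMeasure P)).toReal
        + 24 * m₀ ^ (1 / l) * α ^ (-(1 / l)) ≤
      24 * (m₀ ^ (-(1 / 2) : ℝ) * (wasserstein2 μ (uniformMeasure P)).toReal
        + m₀ ^ (1 / l) * α ^ (-(1 / l))) := by
  have hkR : (0 : ℝ) < k := by exact_mod_cast hk
  have hPR : (0 : ℝ) < P.card := by exact_mod_cast hk.trans hkP
  have hP : P.Nonempty := Finset.card_pos.1 (hk.trans hkP)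
  have hm : 0 < m₀ := by rw [hm₀]; positivity
  have hm1 : m₀ ≤ 1 := by
    rw [hm₀, div_le_one hPR]
    exact_mod_cast hkP
  have hα := hμ.1
  have hbdd := isBounded_support hl hμ
  have hW := wasserstein2_ne_top hbdd hP
  have hne : μ.support.Nonempty := Measure.nonempty_support (IsProbabilityMeasure.ne_zero μ)
  have hnnne (x) : (nn x).Nonempty := Finset.card_pos.1 (by rw [(hnn x).2.1]; exact hk)
  have hr : m₀ ^ (1 / l) * α ^ (-(1 / l)) = (m₀ / α) ^ (1 / l) := by
    rw [Real.div_rpow hm.le hα.le, Real.rpow_neg hα.le, ← div_eq_mul_inv]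
  have hs : m₀ ^ (-(1 / 2) : ℝ) = (√m₀)⁻¹ := by
    rw [Real.rpow_neg hm.le, Real.sqrt_eq_rpow]
  rw [mul_assoc 6, mul_assoc 24, hr, hs]
  set r := (m₀ / α) ^ (1 / l)
  have hr0 : 0 ≤ r := by positivity
  set W := (√m₀)⁻¹ * (wasserstein2 μ (uniformMeasure P)).toReal with hWdef
  have hW0 : 0 ≤ W := by positivity
  have hsm : 0 < √m₀ := Real.sqrt_pos.2 hm
  have hsW : √m₀ * W = (wasserstein2 μ (uniformMeasure P)).toReal := by
    rw [hWdef, mul_inv_cancel_left₀ hsm.ne']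
  have hproj (x) : ∃ y ∈ μ.support, Metric.infDist x μ.support = dist x y :=
    Measure.isClosed_support.exists_infDist_eq_dist hne x
  have hupper (x) : rmsDist (nn x) x ≤ Metric.infDist x μ.support + r + W := by
    obtain ⟨y, hy, hxy⟩ := hproj x
    have hball : ENNReal.ofReal m₀ ≤
        μ (Metric.closedBall x (Metric.infDist x μ.support + r)) := by
      refine (ofReal_le_measure_closedBall hl hμ hm hm1 hy).trans (measure_mono ?_)
      exact Metric.closedBall_subset_closedBall' (by rw [hxy, dist_comm, add_comm])
    have hR : 0 ≤ Metric.infDist x μ.support + r := add_nonneg Metric.infDist_nonneg hr0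
    rw [hm₀] at hball
    have := le_add_toReal_wasserstein2 hW (by positivity) fun π hπ =>
      rmsDist_le_of_plan hk (hnn x) hπ hR hball
    rw [← hm₀, ← hsW, ← mul_add] at this
    exact le_of_mul_le_mul_left this hsm
  have hlower (x) : Metric.infDist x μ.support ≤ rmsDist (nn x) x + W := by
    have h0 := rmsDist_nonneg (nn x) x
    have := le_add_toReal_wasserstein2 hW (by positivity) fun π hπ =>
      infDist_le_of_plan hk (hnn x) hπ
    rw [← hm₀, ← hsW, ← mul_add] at this
    exact le_of_mul_le_mul_left this hsm
  have hkD (x) : kDistance k nn x = rmsDist (nn x) x := by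
    rw [kDistance, rmsDist, (hnn x).2.1]
  have hwD (x) : witnessedKDistance P nn x = √(⨅ p : {p // p ∈ P}, rmsDist (nn p) x ^ 2) := by
    simp only [witnessedKDistance, norm_sub_barycenter_sq_sub_baryWeight (hnnne _)]
  have : Nonempty {p // p ∈ P} := hP.to_subtype
  have hwlower (x) : rmsDist (nn x) x ≤ witnessedKDistance P nn x := by
    rw [hwD]
    refine Real.le_sqrt_of_sq_le (le_ciInf fun p => ?_)
    rw [rmsDist_sq, rmsDist_sq, (hnn x).2.1, (hnn p).2.1]
    refine mul_le_mul_of_nonneg_left ?_ (by positivity)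
    classical
    -- The indicator of `nn p` is a competing weight of mass `k`.
    have := mul_sum_nearest_le (hnn x) (fun q => if q ∈ nn p then 1 else 0) 1
      (fun q _ => by split_ifs <;> norm_num) (fun q _ => by split_ifs <;> norm_num) (by
        rw [← Finset.sum_filter, Finset.filter_mem_eq_inter, Finset.inter_eq_right.2 (hnn p).1]
        simp [(hnn p).2.1])
    simpa only [one_mul, ite_mul, zero_mul, ← Finset.sum_filter, Finset.filter_mem_eq_inter,
      Finset.inter_eq_right.2 (hnn p).1] using this
  have hwupper (x) : witnessedKDistance P nn x ≤ Metric.infDist x μ.support + 3 * r + 3 * W := by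
    obtain ⟨y, hy, hxy⟩ := hproj x
    -- The witness: `p` is within `r + W` of the projection `y`, hence of the support, so `rmsDist
    -- (nn p) p ≤ 2 * (r + W)`. Moving from `p` to `x` adds at most `dist x y + (r + W)`.
    obtain ⟨p, hp, hyp⟩ := exists_mem_dist_le_rmsDist (hnnne y) y
    have h1 := hupper y
    rw [Metric.infDist_zero_of_mem hy] at h1
    have h2 : Metric.infDist p μ.support ≤ dist y p := by
      rw [dist_comm]; exact Metric.infDist_le_dist_of_mem hy
    have h3 := hupper p
    have h4 := rmsDist_le_dist_add (nn p) x p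
    have h5 := dist_triangle x y p
    have h6 : witnessedKDistance P nn x ≤ rmsDist (nn p) x := by
      rw [hwD]
      refine Real.sqrt_le_iff.2 ⟨rmsDist_nonneg _ _, ?_⟩
      exact ciInf_le (f := fun q : {q // q ∈ P} => rmsDist (nn q) x ^ 2)
        (Set.finite_range _).bddBelow ⟨p, (hnn y).1 hp⟩
    linarith
  refine ⟨hW, supNorm_le fun x => ?_, supNorm_le fun x => ?_, by linarith⟩
  · have h1 := hlower x
    have h2 := hwlower x
    have h3 := hwupper x
    exact abs_le.2 ⟨by linarith, by linarith⟩
  · have h1 := hlower x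
    have h2 := hupper x
    rw [hkD]
    exact abs_le.2 ⟨by linarith, by linarith⟩
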